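/- Let $X$ be a measurable space. A domain is a probability measure $D$ on $X\times[0,1]$, the law of a labelled example $(x,y)$; for instance, an input distribution with a labelling function $f:X\to[0,1]$ gives the law of $(x,f(x))$, and binary labels are those with $y\in\{0,1\}$. Write $\mathcal D_D$ for its marginal on $X$. Let $\mathcal H$ be a nonempty class of measurable functions $h:X\to\{0,1\}$ of finite VC dimension $d$. Put $\epsilon_D(h)=\mathbb E_{(x,y)\sim D}|h(x)-y|$ and, for probability measures $P,Q$ on $X$, $$d_{\mathcal H\Delta\mathcal H}(P,Q)=\sup_{h,h'\in\mathcal H}\bigl|P(h(x)\ne h'(x))-Q(h(x)\ne h'(x))\bigr| .$$ Let $S$, $B$, $T$ be domains (source, bridging, target), and let $\mathcal D_\alpha=\tfrac12\mathcal D_S+\tfrac12\mathcal D_B$. Write $\epsilon_D(h_D^*)=\inf_{h\in\mathcal H}\epsilon_D(h)$ (so $h_D^*$ is a minimizer of $\epsilon_D$ over $\mathcal H$ if one exists) and $$\gamma=\inf_{h\in\mathcal H}\bigl(\epsilon_T(h)+\epsilon_S(h)+\epsilon_B(h)\bigr).$$ Assume the usual measurability condition on the class $\mathcal H$ under $S$: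 for all $n$ and all $e_1,\dots,e_n\in\mathbb R$, the function $((x_1,y_1),\dots,(x_n,y_n))\mapsto\sup_{h\in\mathcal H}\bigl|\sum_{i=1}^n e_i|h(x_i)-y_i|\bigr|$ is measurable with respect to the completion of $S^n$ (this is automatic if $\mathcal H$ is countable). Let $m\ge1$, $\delta\in(0,1)$, and let $z_i=(x_i,y_i)$, $i=1,\dots,m$, be independent with law $S$; let $\hat\epsilon_S(h)=\frac1m\sum_{i=1}^m|h(x_i)-y_i|$. Then there is a measurable event of probability at least $1-\delta$ on which every $h_1\in\mathcal H$ that minimizes $\hat\epsilon_S$ over $\mathcal H$ satisfies $$\epsilon_T(h_1)\le\epsilon_T(h_T^*)+\tfrac12\epsilon_B(h_B^*)+2\gamma+d_{\mathcal H\Delta\mathcal H}(\mathcal D_\alpha,\mathcal D_T)+\tfrac12 d_{\mathcal H\Delta\mathcal H}(\mathcal D_S,\mathcal D_B)+2\eta,$$ where $$\eta=2\sqrt{\frac{2d\log(2m+1)+\log(4/\delta)}{m}} .$$ -/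

import Mathlib

open MeasureTheory

namespace BridgingDomain

/-- A labelled example: an input together with a label in `[0,1]`.
A domain is a probability measure on labelled examples. Ordinary binary labels are those
in `{0,1}`; a domain given by an input distribution `D` and a labelling function
`f : X → [0,1]` is the law of `(x, f x)` for `x` distributed according to `D`. -/
abbrev Example (X : Type*) : Type _ := X × unitInterval

/-- The numerical value `0` or `1` of a binary prediction. -/
def val (b : Bool) : ℝ := if b then 1 else 0

/-- The loss `|h(x) - y|` of the binary hypothesis `h` on the labelled example `(x, y)`;
for `y ∈ {0,1}` it is the indicator of `h(x) ≠ y`. -/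
def loss {X : Type*} (h : X → Bool) (z : Example X) : ℝ := |val (h z.1) - (z.2 : ℝ)|

/-- The error `ε_D(h) = E_{(x,y) ∼ D} |h(x) - y|`. -/
noncomputable def error {X : Type*} [MeasurableSpace X] (D : Measure (Example X))
    (h : X → Bool) : ℝ := ∫ z, loss h z ∂D

/-- The empirical error of `h` on the sample `z₁, …, zₘ`. -/
noncomputable def empError {X : Type*} {m : ℕ} (z : Fin m → Example X) (h : X → Bool) : ℝ :=
  (∑ i, loss h (z i)) / m

/-- `h` minimizes the empirical error over the class `H`. -/
def IsEmpiricalMinimizer {X : Type*} {m : ℕ} (H : Set (X → Bool)) (z : Fin m → Example X)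
    (h : X → Bool) : Prop :=
  h ∈ H ∧ ∀ g ∈ H, empError z h ≤ empError z g

/-- The optimal error over `H`, that is `ε_D(h*)` for `h* = argmin_{h ∈ H} ε_D(h)`. It is written
as an infimum, so that no existence of a minimizer has to be assumed. -/
noncomputable def bestError {X : Type*} [MeasurableSpace X] (H : Set (X → Bool))
    (D : Measure (Example X)) : ℝ := ⨅ h : H, error D h

/-- The optimal joint error `γ = min_{h ∈ H} (ε_T(h) + ε_S(h) + ε_B(h))`, as an infimum. -/
noncomputable def jointError {X : Type*} [MeasurableSpace X] (H : Set (X → Bool))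
    (T S B : Measure (Example X)) : ℝ := ⨅ h : H, (error T h + error S h + error B h)

/-- If a minimizer `h*` exists, then `bestError` is its error. -/
theorem bestError_eq {X : Type*} [MeasurableSpace X] {H : Set (X → Bool)}
    {D : Measure (Example X)} {h : X → Bool} (hh : h ∈ H)
    (hmin : ∀ g ∈ H, error D h ≤ error D g) : bestError H D = error D h :=
  IsLeast.csInf_eq ⟨⟨⟨h, hh⟩, rfl⟩, by rintro _ ⟨g, rfl⟩; exact hmin g g.2⟩

/-- The divergence
`d_{HΔH}(P, Q) = sup_{h,h' ∈ H} |P(h(x) ≠ h'(x)) - Q(h(x) ≠ h'(x))|` of two laws of inputs. -/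
noncomputable def divergence {X : Type*} [MeasurableSpace X] (H : Set (X → Bool))
    (P Q : Measure X) : ℝ :=
  ⨆ p : H × H, |P.real {x | p.1.1 x ≠ p.2.1 x} - Q.real {x | p.1.1 x ≠ p.2.1 x}|

/-- The mixture of two measures with weights `(1/2, 1/2)`. -/
noncomputable def mixture {X : Type*} [MeasurableSpace X] (P Q : Measure X) : Measure X :=
  (2⁻¹ : ENNReal) • P + (2⁻¹ : ENNReal) • Q

/-- `H` shatters the finite set `C`: every subset of `C` is cut out by some `h ∈ H`. -/
def Shatters {X : Type*} (H : Set (X → Bool)) (C : Finset X) : Prop :=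
  ∀ s ⊆ C, ∃ h ∈ H, ∀ x ∈ C, (h x = true ↔ x ∈ s)

/-- The Vapnik–Chervonenkis dimension, possibly infinite. -/
noncomputable def vcDim {X : Type*} (H : Set (X → Bool)) : ℕ∞ :=
  ⨆ C : {C : Finset X // Shatters H C}, (C.1.card : ℕ∞)

/-- The usual measurability condition on a possibly uncountable class in empirical process theory
(the loss class of `H` is a `D`-measurable class): for every `n` and all real coefficients
`e₁, …, eₙ`, the function `(z₁, …, zₙ) ↦ sup_{h ∈ H} |∑ eᵢ · loss h zᵢ|` is measurable with respect
to the completion of the product measure `Dⁿ`. -/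
def IsMeasurableClass {X : Type*} [MeasurableSpace X] (H : Set (X → Bool))
    (D : Measure (Example X)) : Prop :=
  ∀ (n : ℕ) (e : Fin n → ℝ),
    AEMeasurable (fun z : Fin n → Example X => ⨆ h : H, |∑ i, e i * loss h.1 (z i)|)
      (Measure.pi fun _ => D)

/-- The deviation term `η = 2 √((2 d log(2m+1) + log(4/δ)) / m)`. -/
noncomputable def deviation (d m : ℕ) (δ : ℝ) : ℝ :=
  2 * √((2 * d * Real.log (2 * m + 1) + Real.log (4 / δ)) / m)

end BridgingDomain

namespace BridgingDomain

/-! ### The loss and the error -/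

section Loss

variable {X : Type*}

/-! For `h` in the class, `ε_T(h₁) ≤ ε_T(h) + D_T(h₁ ≠ h)`. Passing from `D_T` to `D_α`, and from
the `B` half of `D_α` to `S`, costs the two divergence terms. What remains is `D_S(h₁ ≠ h) ≤ ε_S(h₁)
+ ε_S(h)`. If `ε_S(h₁) ≤ ε_S(h) + c` for all `h`, an infimum over `h` gives the bound with `c` in
place of `2η` (`error_le_of_forall_error_source_le`); empirical minimality and uniform convergence
supply `c = 2η`.

Uniform convergence is proved through an exponential moment. Jensen's inequality replaces the true
error by the error on an independent second sample (`exp_abs_sum_sub_error_le`), and exchangeability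
of the double sample inserts random signs. For fixed points, Sauer–Shelah leaves at most `(2m+1)^d`
label patterns, and each signed sum is subgaussian by `cosh a ≤ exp (a²/2)` (`sum_exp_supLoss_le`).
Markov's inequality concludes. -/

theorem val_mem_Icc (b : Bool) : val b ∈ Set.Icc (0 : ℝ) 1 := by
  cases b <;> simp [val]

theorem loss_nonneg (h : X → Bool) (z : Example X) : 0 ≤ loss h z := abs_nonneg _

theorem loss_le_one (h : X → Bool) (z : Example X) : loss h z ≤ 1 := by
  have h1 := val_mem_Icc (h z.1)
  have h2 := z.2.2
  exact abs_sub_le_iff.2 ⟨by linarith [h1.2, h2.1], by linarith [h1.1, h2.2]⟩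

theorem loss_congr {h h' : X → Bool} {z : Example X} (hz : h z.1 = h' z.1) :
    loss h z = loss h' z := by
  simp [loss, hz]

theorem abs_val_sub_val (h h' : X → Bool) (x : X) :
    |val (h x) - val (h' x)| = Set.indicator {x | h x ≠ h' x} 1 x := by
  cases hx : h x <;> cases hx' : h' x <;> simp [val, hx, hx']

variable [MeasurableSpace X]

theorem measurable_loss {h : X → Bool} (hh : Measurable h) :
    Measurable (loss h) := by
  have : Measurable val := measurable_of_countable _
  unfold loss
  fun_prop

theorem integrable_loss {D : Measure (Example X)} [IsFiniteMeasure D] {h : X → Bool}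
    (hh : Measurable h) : Integrable (loss h) D :=
  .of_bound (measurable_loss hh).aestronglyMeasurable 1 <| .of_forall fun z => by
    rw [Real.norm_of_nonneg (loss_nonneg h z)]; exact loss_le_one h z

theorem error_nonneg (D : Measure (Example X)) (h : X → Bool) : 0 ≤ error D h :=
  integral_nonneg (loss_nonneg h)

theorem measurableSet_ne {h h' : X → Bool} (hh : Measurable h) (hh' : Measurable h') :
    MeasurableSet {x | h x ≠ h' x} :=
  (measurableSet_eq_fun hh hh').compl

theorem integral_indicator_ne (D : Measure (Example X)) {h h' : X → Bool}
    (hh : Measurable h) (hh' : Measurable h') :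
    ∫ z, Set.indicator {x | h x ≠ h' x} (1 : X → ℝ) z.1 ∂D = D.fst.real {x | h x ≠ h' x} := by
  rw [← integral_indicator_one (measurableSet_ne hh hh'), Measure.fst,
    integral_map measurable_fst.aemeasurable]
  exact (measurable_one.indicator (measurableSet_ne hh hh')).aestronglyMeasurable

theorem integrable_indicator_ne (D : Measure (Example X)) [IsFiniteMeasure D] {h h' : X → Bool}
    (hh : Measurable h) (hh' : Measurable h') :
    Integrable (fun z : Example X => Set.indicator {x | h x ≠ h' x} (1 : X → ℝ) z.1) D :=
  .of_bound ((measurable_one.indicator (measurableSet_ne hh hh')).comp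
    measurable_fst).aestronglyMeasurable 1 <| .of_forall fun z => by
      by_cases hz : h z.1 = h' z.1 <;> simp [hz]

/-- The probability that two hypotheses disagree is at most the sum of their errors. -/
theorem fst_real_ne_le_error_add_error (D : Measure (Example X)) [IsFiniteMeasure D]
    {h h' : X → Bool} (hh : Measurable h) (hh' : Measurable h') :
    D.fst.real {x | h x ≠ h' x} ≤ error D h + error D h' := by
  rw [← integral_indicator_ne D hh hh', error, error,
    ← integral_add (integrable_loss hh) (integrable_loss hh')]
  refine integral_mono (integrable_indicator_ne D hh hh')
    ((integrable_loss hh).add (integrable_loss hh')) fun z => ?_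
  simp only [← abs_val_sub_val, loss]
  rw [abs_sub_comm (val (h' z.1))]
  exact abs_sub_le _ _ _

/-- The errors of two hypotheses differ by at most the probability that they disagree. -/
theorem error_le_error_add_fst_real_ne (D : Measure (Example X)) [IsFiniteMeasure D]
    {h h' : X → Bool} (hh : Measurable h) (hh' : Measurable h') :
    error D h ≤ error D h' + D.fst.real {x | h x ≠ h' x} := by
  rw [← integral_indicator_ne D hh hh', error, error,
    ← integral_add (integrable_loss hh') (integrable_indicator_ne D hh hh')]
  refine integral_mono (integrable_loss hh)
    ((integrable_loss hh').add (integrable_indicator_ne D hh hh')) fun z => ?_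
  simp only [← abs_val_sub_val, loss]
  linarith [abs_sub_le (val (h z.1)) (val (h' z.1)) z.2]

end Loss

/-! ### Disagreement divergence and the deterministic bound -/

section Divergence

variable {X : Type*} [MeasurableSpace X]

instance isProbabilityMeasure_mixture (P Q : Measure X) [IsProbabilityMeasure P]
    [IsProbabilityMeasure Q] : IsProbabilityMeasure (mixture P Q) :=
  ⟨by simp [mixture, ENNReal.inv_two_add_inv_two]⟩

theorem mixture_real_apply (P Q : Measure X) [IsFiniteMeasure P] [IsFiniteMeasure Q] (s : Set X) :
    (mixture P Q).real s = 1 / 2 * P.real s + 1 / 2 * Q.real s := by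
  simp only [mixture, Measure.real, Measure.add_apply, Measure.smul_apply, smul_eq_mul]
  rw [ENNReal.toReal_add (by finiteness) (by finiteness)]
  simp

theorem abs_real_sub_real_le_divergence {H : Set (X → Bool)} (P Q : Measure X)
    [IsProbabilityMeasure P] [IsProbabilityMeasure Q] {h h' : X → Bool} (hh : h ∈ H)
    (hh' : h' ∈ H) :
    |P.real {x | h x ≠ h' x} - Q.real {x | h x ≠ h' x}| ≤ divergence H P Q := by
  refine le_ciSup (f := fun p : H × H =>
    |P.real {x | p.1.1 x ≠ p.2.1 x} - Q.real {x | p.1.1 x ≠ p.2.1 x}|) ⟨1, ?_⟩ (⟨h, hh⟩, ⟨h', hh'⟩)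
  rintro _ ⟨p, rfl⟩
  exact abs_sub_le_iff.2
    ⟨by linarith [measureReal_le_one (μ := P) (s := {x | p.1.1 x ≠ p.2.1 x}),
      measureReal_nonneg (μ := Q) (s := {x | p.1.1 x ≠ p.2.1 x})],
    by linarith [measureReal_le_one (μ := Q) (s := {x | p.1.1 x ≠ p.2.1 x}),
      measureReal_nonneg (μ := P) (s := {x | p.1.1 x ≠ p.2.1 x})]⟩

theorem bestError_nonneg (H : Set (X → Bool)) (D : Measure (Example X)) : 0 ≤ bestError H D :=
  Real.iInf_nonneg fun h => error_nonneg D h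

/-- If the source error of `h₁` exceeds that of `h` by at most `c`, then the target error of `h₁`
is controlled by the joint error of `h` and the divergences through the bridging domain. -/
theorem error_le_of_error_source_le (S B T : Measure (Example X))
    [IsProbabilityMeasure S] [IsProbabilityMeasure B] [IsProbabilityMeasure T]
    {H : Set (X → Bool)} (hmeas : ∀ h ∈ H, Measurable h) {h₁ h : X → Bool} (hh₁ : h₁ ∈ H)
    (hh : h ∈ H) {c : ℝ} (hS : error S h₁ ≤ error S h + c) :
    error T h₁ ≤ 2 * (error T h + error S h + error B h)
      + divergence H (mixture S.fst B.fst) T.fst + 1 / 2 * divergence H S.fst B.fst + c := by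
  have hT := error_le_error_add_fst_real_ne T (hmeas _ hh₁) (hmeas _ hh)
  have hSd := fst_real_ne_le_error_add_error S (hmeas _ hh₁) (hmeas _ hh)
  have hα := abs_le.1 (abs_real_sub_real_le_divergence (mixture S.fst B.fst) T.fst hh₁ hh)
  have hSB := abs_le.1 (abs_real_sub_real_le_divergence S.fst B.fst hh₁ hh)
  rw [mixture_real_apply] at hα
  linarith [hα.1, hSB.1, error_nonneg T h, error_nonneg B h]

/-- The deterministic part of the bound: it holds for every `h₁` whose source error exceeds the
optimal one by at most `c`. -/
theorem error_le_of_forall_error_source_le (S B T : Measure (Example X))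
    [IsProbabilityMeasure S] [IsProbabilityMeasure B] [IsProbabilityMeasure T]
    {H : Set (X → Bool)} (hmeas : ∀ h ∈ H, Measurable h) {h₁ : X → Bool} (hh₁ : h₁ ∈ H)
    {c : ℝ} (hS : ∀ h ∈ H, error S h₁ ≤ error S h + c) :
    error T h₁ ≤ bestError H T + 1 / 2 * bestError H B + 2 * jointError H T S B
      + divergence H (mixture S.fst B.fst) T.fst + 1 / 2 * divergence H S.fst B.fst + c := by
  have : Nonempty H := ⟨⟨h₁, hh₁⟩⟩
  -- The bound for a single `h` is solved for its joint error, so that the infimum over `h` can be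
  -- taken.
  have key : (error T h₁ - divergence H (mixture S.fst B.fst) T.fst
      - 1 / 2 * divergence H S.fst B.fst - c) / 2 ≤ jointError H T S B :=
    le_ciInf fun h => by
      linarith [error_le_of_error_source_le S B T hmeas hh₁ h.2 (hS h h.2)]
  -- The two optimal errors enter only as nonnegative slack.
  linarith [bestError_nonneg H T, bestError_nonneg H B]

end Divergence

/-! ### The growth function -/

section Growth

open Finset

/-- Termwise comparison with the binomial expansion of `(n + 1) ^ d`: `n.choose k ≤ n ^ k ≤ n ^ k *
d.choose k`. -/
theorem sum_Iic_choose_le (n d : ℕ) : ∑ k ∈ Iic d, n.choose k ≤ (n + 1) ^ d := by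
  rw [add_pow, ← Nat.range_succ_eq_Iic]
  refine sum_le_sum fun k hk => ?_
  rw [one_pow, mul_one]
  exact (Nat.choose_le_pow n k).trans (Nat.le_mul_of_pos_right _
    (Nat.choose_pos (Nat.lt_succ_iff.1 (mem_range.1 hk))))

variable {X ι : Type*} [Fintype ι] [DecidableEq ι]

/-- The label patterns cut out by `H` on the points `x i`. -/
noncomputable def patterns (H : Set (X → Bool)) (x : ι → X) : Finset (Finset ι) :=
  open Classical in {A | ∃ h ∈ H, A = ({i | h (x i) = true} : Finset ι)}

omit [DecidableEq ι] in
theorem mem_patterns {H : Set (X → Bool)} {x : ι → X} {A : Finset ι} :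
    A ∈ patterns H x ↔ ∃ h ∈ H, A = ({i | h (x i) = true} : Finset ι) := by
  simp [patterns]

theorem card_le_of_vcDim_eq {H : Set (X → Bool)} {d : ℕ} (hd : vcDim H = d) {C : Finset X}
    (hC : Shatters H C) : #C ≤ d := by
  have := le_iSup (fun C : {C : Finset X // Shatters H C} => (C.1.card : ℕ∞)) ⟨C, hC⟩
  exact_mod_cast this.trans_eq hd

theorem card_le_of_shatters_patterns {H : Set (X → Bool)} {d : ℕ} (hd : vcDim H = d) {x : ι → X}
    {A : Finset ι} (hA : (patterns H x).Shatters A) : #A ≤ d := by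
  classical
  -- Equal points get equal labels, so no pattern separates their indices; a shattered index set
  -- therefore has distinct points, and its image is shattered by `H`.
  have hinj : Set.InjOn x A := by
    intro i hi j hj hij
    obtain ⟨u, hu, hAu⟩ := hA (singleton_subset_iff.2 hi)
    obtain ⟨h, -, rfl⟩ := mem_patterns.1 hu
    have h1 : i ∈ A ∩ ({i | h (x i) = true} : Finset ι) := by simp [hAu]
    have h2 : j ∈ A ∩ ({i | h (x i) = true} : Finset ι) := by
      simp only [mem_inter, mem_filter, mem_univ, true_and] at h1 ⊢
      exact ⟨hj, hij ▸ h1.2⟩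
    rw [hAu, mem_singleton] at h2
    exact h2.symm
  rw [← card_image_of_injOn hinj]
  refine card_le_of_vcDim_eq hd fun s hs => ?_
  obtain ⟨u, hu, hAu⟩ := hA (filter_subset (fun i => x i ∈ s) A)
  obtain ⟨h, hh, rfl⟩ := mem_patterns.1 hu
  refine ⟨h, hh, fun y hy => ?_⟩
  obtain ⟨i, hi, rfl⟩ := mem_image.1 hy
  have := congrArg (i ∈ ·) hAu
  simpa [hi] using this

/-- The Sauer–Shelah bound for the number of label patterns. -/
theorem card_patterns_le {H : Set (X → Bool)} {d : ℕ} (hd : vcDim H = d) (x : ι → X) :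
    #(patterns H x) ≤ (Fintype.card ι + 1) ^ d := by
  refine (card_le_card_shatterer _).trans (card_shatterer_le_sum_vcDim.trans ?_)
  refine le_trans (sum_le_sum_of_subset (Iic_subset_Iic.2 ?_)) (sum_Iic_choose_le _ d)
  exact Finset.sup_le fun A hA => card_le_of_shatters_patterns hd (mem_shatterer.1 hA)

end Growth

/-! ### Rademacher averages of a finite class -/

section Rademacher

open Finset Real

variable {κ : Type*} [Fintype κ] [DecidableEq κ]

/-- The sign `±1` coded by a Boolean. -/
def sign (b : Bool) : ℝ := if b then 1 else -1

/-- The exponential factors over coordinates, and each sign contributes `exp a + exp (-a)`. -/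
theorem sum_exp_sign_eq (a : κ → ℝ) :
    ∑ σ : κ → Bool, exp (∑ i, sign (σ i) * a i) = ∏ i, (2 * cosh (a i)) := by
  simp_rw [exp_sum]
  rw [← Fintype.piFinset_univ, ← prod_univ_sum (fun _ => univ) fun i b => exp (sign b * a i)]
  refine prod_congr rfl fun i _ => ?_
  rw [Fintype.sum_bool, cosh_eq]
  simp only [sign]
  simp
  ring

theorem sum_exp_sign_le {a : κ → ℝ} {c : ℝ} (ha : ∀ i, |a i| ≤ c) :
    ∑ σ : κ → Bool, exp (∑ i, sign (σ i) * a i)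
      ≤ 2 ^ Fintype.card κ * exp (Fintype.card κ * c ^ 2 / 2) := by
  rw [sum_exp_sign_eq, prod_mul_distrib, prod_const, card_univ]
  gcongr
  calc ∏ i, cosh (a i) ≤ ∏ _i : κ, exp (c ^ 2 / 2) := by
        refine prod_le_prod (fun i _ => (cosh_pos _).le) fun i _ => ?_
        refine (cosh_le_exp_half_sq _).trans (exp_le_exp.2 ?_)
        linarith [sq_le_sq.2 ((ha i).trans (le_abs_self c))]
    _ = _ := by rw [prod_const, card_univ, ← exp_nat_mul]; ring_nf

theorem sum_exp_abs_sign_le {a : κ → ℝ} {c : ℝ} (ha : ∀ i, |a i| ≤ c) :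
    ∑ σ : κ → Bool, exp |∑ i, sign (σ i) * a i|
      ≤ 2 * (2 ^ Fintype.card κ * exp (Fintype.card κ * c ^ 2 / 2)) := by
  have h1 := sum_exp_sign_le ha
  have h2 := sum_exp_sign_le (a := fun i => -a i) (c := c) (by simpa using ha)
  have h3 : ∑ σ : κ → Bool, exp |∑ i, sign (σ i) * a i| ≤
      ∑ σ : κ → Bool, (exp (∑ i, sign (σ i) * a i) + exp (∑ i, sign (σ i) * -a i)) := by
    refine sum_le_sum fun σ _ => ?_
    simp only [mul_neg, sum_neg_distrib]
    exact exp_abs_le _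
  rw [sum_add_distrib] at h3
  linarith

end Rademacher

end BridgingDomain

namespace BridgingDomain

/-! ### Symmetrization -/

section Symmetrization

open Finset Real

variable {X ι κ : Type*} [Fintype ι] [Fintype κ]

/-- The supremum over the class of a signed combination of losses. -/
noncomputable def supLoss (H : Set (X → Bool)) (e : ι → ℝ) (z : ι → Example X) : ℝ :=
  ⨆ h : H, |∑ i, e i * loss h.1 (z i)|

theorem abs_sum_le_supLoss {H : Set (X → Bool)} (e : ι → ℝ) (z : ι → Example X) {h : X → Bool}
    (hh : h ∈ H) : |∑ i, e i * loss h (z i)| ≤ supLoss H e z := by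
  refine le_ciSup (f := fun h : H => |∑ i, e i * loss h.1 (z i)|) ⟨∑ i, |e i|, ?_⟩ ⟨h, hh⟩
  rintro _ ⟨g, rfl⟩
  refine (abs_sum_le_sum_abs _ _).trans (sum_le_sum fun i _ => ?_)
  rw [abs_mul, abs_of_nonneg (loss_nonneg _ _)]
  exact mul_le_of_le_one_right (abs_nonneg _) (loss_le_one _ _)

theorem supLoss_comp (H : Set (X → Bool)) (f : ι ≃ κ) (e : κ → ℝ) (z : κ → Example X) :
    supLoss H (e ∘ f) (z ∘ f) = supLoss H e z := by
  unfold supLoss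
  congr! 3 with h
  exact f.sum_comp fun i => e i * loss h.1 (z i)

/-- On fixed inputs the losses depend on `h` only through its pattern, whatever the labels, so one
representative per pattern replaces `H`. -/
theorem exists_finset_representatives [DecidableEq ι] {H : Set (X → Bool)} {d : ℕ}
    (hd : vcDim H = d) (x : ι → X) :
    ∃ G : Finset (X → Bool), #G ≤ (Fintype.card ι + 1) ^ d ∧
      ∀ h ∈ H, ∃ g ∈ G, ∀ i, h (x i) = g (x i) := by
  classical
  choose! r hr using fun A (hA : A ∈ patterns H x) => (mem_patterns.1 hA)
  refine ⟨(patterns H x).image r, card_image_le.trans (card_patterns_le hd x), fun h hh => ?_⟩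
  have hA : ({i | h (x i) = true} : Finset ι) ∈ patterns H x := mem_patterns.2 ⟨h, hh, rfl⟩
  refine ⟨_, mem_image_of_mem r hA, fun i => ?_⟩
  have := congrArg (i ∈ ·) (hr _ hA).2
  rw [Bool.eq_iff_iff]
  simpa using this

/-- The coefficients `± c` of a symmetrized sample, with signs `σ`. -/
def signedCoeff (c : ℝ) (σ : κ → Bool) : κ ⊕ κ → ℝ :=
  Sum.elim (fun i => c * sign (σ i)) fun i => -(c * sign (σ i))

theorem sum_signedCoeff (c : ℝ) (σ : κ → Bool) (f : κ ⊕ κ → ℝ) :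
    ∑ j, signedCoeff c σ j * f j = ∑ i, sign (σ i) * (c * (f (.inl i) - f (.inr i))) := by
  simp only [signedCoeff, Fintype.sum_sum_type, Sum.elim_inl, Sum.elim_inr, ← sum_add_distrib]
  exact sum_congr rfl fun i _ => by ring

theorem sum_exp_supLoss_le [DecidableEq κ] {H : Set (X → Bool)} (hne : H.Nonempty) {d : ℕ}
    (hd : vcDim H = d) {c : ℝ} (hc : 0 ≤ c) (z : κ ⊕ κ → Example X) :
    ∑ σ : κ → Bool, exp (supLoss H (signedCoeff c σ) z) ≤
      2 ^ Fintype.card κ * (2 * (2 * Fintype.card κ + 1) ^ d *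
        exp (Fintype.card κ * c ^ 2 / 2)) := by
  have : Nonempty H := hne.to_subtype
  obtain ⟨G, hG, hGH⟩ := exists_finset_representatives hd fun j => (z j).1
  have hsup (σ : κ → Bool) : exp (supLoss H (signedCoeff c σ) z) ≤
      ∑ g ∈ G, exp |∑ j, signedCoeff c σ j * loss g (z j)| := by
    obtain ⟨h₀, hh₀⟩ := hne
    obtain ⟨g₀, hg₀, -⟩ := hGH h₀ hh₀
    have hpos : 0 < ∑ g ∈ G, exp |∑ j, signedCoeff c σ j * loss g (z j)| :=
      sum_pos (fun _ _ => exp_pos _) ⟨g₀, hg₀⟩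
    -- Taking logarithms exposes the supremum, which can then be bounded one hypothesis at a time.
    rw [← le_log_iff_exp_le hpos]
    refine ciSup_le fun h => ?_
    rw [le_log_iff_exp_le hpos]
    obtain ⟨g, hg, hgh⟩ := hGH h h.2
    rw [sum_congr rfl fun j _ => congrArg (signedCoeff c σ j * ·) (loss_congr (hgh j))]
    exact single_le_sum (f := fun g => exp |∑ j, signedCoeff c σ j * loss g (z j)|)
      (fun _ _ => (exp_pos _).le) hg
  calc ∑ σ : κ → Bool, exp (supLoss H (signedCoeff c σ) z)
      ≤ ∑ σ : κ → Bool, ∑ g ∈ G, exp |∑ j, signedCoeff c σ j * loss g (z j)| :=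
        sum_le_sum fun σ _ => hsup σ
    _ = ∑ g ∈ G, ∑ σ : κ → Bool, exp |∑ j, signedCoeff c σ j * loss g (z j)| := sum_comm
    _ ≤ ∑ g ∈ G, 2 * (2 ^ Fintype.card κ * exp (Fintype.card κ * c ^ 2 / 2)) := by
        refine sum_le_sum fun g _ => ?_
        simp_rw [sum_signedCoeff]
        refine sum_exp_abs_sign_le fun i => ?_
        rw [abs_mul, abs_of_nonneg hc]
        refine mul_le_of_le_one_right hc (abs_sub_le_iff.2 ⟨?_, ?_⟩) <;>
        linarith [loss_nonneg g (z (.inl i)), loss_nonneg g (z (.inr i)),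
          loss_le_one g (z (.inl i)), loss_le_one g (z (.inr i))]
    _ = #G * (2 * (2 ^ Fintype.card κ * exp (Fintype.card κ * c ^ 2 / 2))) := by
        rw [sum_const, nsmul_eq_mul]
    _ ≤ ((2 * Fintype.card κ + 1) ^ d : ℝ) *
          (2 * (2 ^ Fintype.card κ * exp (Fintype.card κ * c ^ 2 / 2))) := by
        gcongr
        rw [Fintype.card_sum, ← two_mul] at hG
        exact_mod_cast hG
    _ = _ := by ring

/-- The permutation of a double sample which swaps the pairs whose sign is negative. -/
def swapPerm (σ : κ → Bool) : Equiv.Perm (κ ⊕ κ) :=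
  Function.Involutive.toPerm
    (Sum.elim (fun i => if σ i then .inl i else .inr i)
      fun i => if σ i then .inr i else .inl i) <| by
    rintro (i | i) <;> cases h : σ i <;> simp [h]

omit [Fintype κ] in
theorem signedCoeff_comp_swapPerm (c : ℝ) (σ : κ → Bool) :
    signedCoeff c (fun _ => true) ∘ swapPerm σ = signedCoeff c σ := by
  ext (i | i) <;> cases h : σ i <;>
    simp [swapPerm, Function.Involutive.toPerm, signedCoeff, sign, h]

variable [MeasurableSpace X]

theorem measurePreserving_comp_equiv (D : Measure (Example X)) [IsProbabilityMeasure D]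
    (f : ι ≃ κ) :
    MeasurePreserving (fun z : κ → Example X => z ∘ f) (.pi fun _ => D) (.pi fun _ => D) := by
  have := measurePreserving_arrowCongr' (fun _ : κ => D) (fun _ : ι => D) f.symm
    (MeasurableEquiv.refl (Example X)) fun _ => MeasurePreserving.id D
  exact this

theorem aemeasurable_supLoss {H : Set (X → Bool)} {D : Measure (Example X)}
    [IsProbabilityMeasure D] (hclass : IsMeasurableClass H D) (e : ι → ℝ) :
    AEMeasurable (supLoss H e) (.pi fun _ => D) := by
  have h := (hclass _ (e ∘ (Fintype.equivFin ι).symm)).comp_quasiMeasurePreserving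
    (measurePreserving_comp_equiv D (Fintype.equivFin ι).symm).quasiMeasurePreserving
  refine h.congr (.of_forall fun z => ?_)
  exact supLoss_comp H (Fintype.equivFin ι).symm e z

theorem aemeasurable_ofReal_exp_supLoss {H : Set (X → Bool)} {D : Measure (Example X)}
    [IsProbabilityMeasure D] (hclass : IsMeasurableClass H D) (e : ι → ℝ) :
    AEMeasurable (fun z => ENNReal.ofReal (exp (supLoss H e z))) (.pi fun _ => D) :=
  (aemeasurable_supLoss hclass e).exp.ennreal_ofReal

/-- Flipping a sign amounts to swapping the two members of a pair, which preserves the product law.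
-/
theorem lintegral_exp_supLoss_signedCoeff {H : Set (X → Bool)} {D : Measure (Example X)}
    [IsProbabilityMeasure D] (hclass : IsMeasurableClass H D) (c : ℝ) (σ : κ → Bool) :
    ∫⁻ z, ENNReal.ofReal (exp (supLoss H (signedCoeff c σ) z)) ∂(.pi fun _ : κ ⊕ κ => D) =
      ∫⁻ z, ENNReal.ofReal (exp (supLoss H (signedCoeff c fun _ => true) z))
        ∂(.pi fun _ : κ ⊕ κ => D) := by
  have hmp := measurePreserving_comp_equiv D (swapPerm σ)
  rw [← hmp.map_eq, lintegral_map' _ hmp.aemeasurable, hmp.map_eq]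
  · refine lintegral_congr fun z => ?_
    rw [← supLoss_comp H (swapPerm σ) (signedCoeff c fun _ => true) z, signedCoeff_comp_swapPerm]
  · rw [hmp.map_eq]
    exact aemeasurable_ofReal_exp_supLoss hclass _

/-- The exponential moment of the symmetrized supremum. -/
theorem lintegral_exp_supLoss_le {H : Set (X → Bool)} (hne : H.Nonempty) {d : ℕ}
    (hd : vcDim H = d) {D : Measure (Example X)} [IsProbabilityMeasure D]
    (hclass : IsMeasurableClass H D) {c : ℝ} (hc : 0 ≤ c) :
    ∫⁻ z, ENNReal.ofReal (exp (supLoss H (signedCoeff c fun _ : κ => true) z))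
        ∂(.pi fun _ => D) ≤
      ENNReal.ofReal (2 * (2 * Fintype.card κ + 1) ^ d * exp (Fintype.card κ * c ^ 2 / 2)) := by
  classical
  set I := ∫⁻ z, ENNReal.ofReal (exp (supLoss H (signedCoeff c fun _ : κ => true) z))
        ∂(.pi fun _ => D) with hI
  -- All sign choices give the same integral, so `2 ^ card κ` copies of `I` form the integral of the
  -- sum over signs, which is bounded pointwise.
  have key : (2 : ENNReal) ^ Fintype.card κ * I ≤ 2 ^ Fintype.card κ *
      ENNReal.ofReal (2 * (2 * Fintype.card κ + 1) ^ d * exp (Fintype.card κ * c ^ 2 / 2)) := by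
    calc (2 : ENNReal) ^ Fintype.card κ * I
        = ∑ σ : κ → Bool, ∫⁻ z, ENNReal.ofReal (exp (supLoss H (signedCoeff c σ) z))
            ∂(.pi fun _ => D) := by
          simp_rw [lintegral_exp_supLoss_signedCoeff hclass, ← hI]
          simp
      _ = ∫⁻ z, ∑ σ : κ → Bool, ENNReal.ofReal (exp (supLoss H (signedCoeff c σ) z))
            ∂(.pi fun _ => D) :=
          (lintegral_finsetSum' _ fun σ _ => aemeasurable_ofReal_exp_supLoss hclass _).symm
      _ ≤ ∫⁻ _, ENNReal.ofReal (2 ^ Fintype.card κ * (2 * (2 * Fintype.card κ + 1) ^ d *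
            exp (Fintype.card κ * c ^ 2 / 2))) ∂(.pi fun _ : κ ⊕ κ => D) := by
          refine lintegral_mono fun z => ?_
          rw [← ENNReal.ofReal_sum_of_nonneg fun _ _ => (exp_pos _).le]
          exact ENNReal.ofReal_le_ofReal (sum_exp_supLoss_le hne hd hc z)
      _ = _ := by
          rw [lintegral_const, measure_univ, mul_one, ENNReal.ofReal_mul (by positivity),
            ENNReal.ofReal_pow (by norm_num), ENNReal.ofReal_ofNat]
  exact (ENNReal.mul_le_mul_iff_right (by simp) (by finiteness)).1 key

/-- Jensen's inequality for a second, independent sample. -/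
theorem exp_abs_sum_sub_error_le (D : Measure (Example X)) [IsProbabilityMeasure D]
    {h : X → Bool} (hh : Measurable h) (c : ℝ) (z : κ → Example X) :
    ENNReal.ofReal (exp |c * (∑ i, loss h (z i) - Fintype.card κ * error D h)|) ≤
      ∫⁻ z' : κ → Example X, ENNReal.ofReal (exp |∑ i, c * (loss h (z i) - loss h (z' i))|)
        ∂(.pi fun _ => D) := by
  set f : (κ → Example X) → ℝ := fun z' => ∑ i, c * (loss h (z i) - loss h (z' i)) with hf
  have hi (i : κ) : Integrable (fun z' : κ → Example X => loss h (z' i)) (.pi fun _ => D) :=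
    integrable_comp_eval (integrable_loss hh)
  have hci (i : κ) : Integrable (fun z' : κ → Example X => c * (loss h (z i) - loss h (z' i)))
      (.pi fun _ => D) := ((integrable_const _).sub (hi i)).const_mul c
  have hfi : Integrable f (.pi fun _ => D) := integrable_finsetSum _ fun i _ => hci i
  have hfe : ∫ z', f z' ∂(.pi fun _ => D) =
      c * (∑ i, loss h (z i) - Fintype.card κ * error D h) := by
    rw [hf, integral_finsetSum _ fun i _ => hci i]
    simp_rw [integral_const_mul]
    rw [← mul_sum]
    simp_rw [fun i => integral_sub (integrable_const (loss h (z i))) (hi i),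
      fun i : κ => integral_comp_eval (μ := fun _ : κ => D) (i := i)
        (integrable_loss hh (D := D)).aestronglyMeasurable]
    simp [error]
  have hbound (z') : |f z'| ≤ Fintype.card κ * |c| := by
    refine (abs_sum_le_sum_abs _ _).trans ((sum_le_card_nsmul _ _ |c| fun i _ => ?_).trans_eq ?_)
    · rw [abs_mul]
      refine mul_le_of_le_one_right (abs_nonneg c) (abs_sub_le_iff.2 ⟨?_, ?_⟩) <;>
      linarith [loss_nonneg h (z i), loss_nonneg h (z' i), loss_le_one h (z i),
        loss_le_one h (z' i)]
    · rw [nsmul_eq_mul, card_univ]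
  have hexp : Integrable (fun z' => exp |f z'|) (.pi fun _ => D) := by
    refine .of_bound (continuous_exp.comp continuous_abs |>.comp_aestronglyMeasurable
      hfi.aestronglyMeasurable) (exp (Fintype.card κ * |c|)) (.of_forall fun z' => ?_)
    rw [norm_of_nonneg (exp_pos _).le]
    exact exp_le_exp.2 (hbound z')
  rw [← ofReal_integral_eq_lintegral_ofReal hexp (.of_forall fun _ => (exp_pos _).le)]
  refine ENNReal.ofReal_le_ofReal ?_
  rw [← hfe]
  refine (exp_le_exp.2 abs_integral_le_integral_abs).trans ?_
  exact convexOn_exp.map_integral_le continuous_exp.continuousOn isClosed_univ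
    (.of_forall fun _ => Set.mem_univ _) hfi.abs hexp

/-- The moment bound for the uniform deviation: there is an almost everywhere measurable
majorant of the exponential of every single deviation. -/
theorem exists_majorant {H : Set (X → Bool)} (hne : H.Nonempty) (hmeas : ∀ h ∈ H, Measurable h)
    {d : ℕ} (hd : vcDim H = d) {D : Measure (Example X)} [IsProbabilityMeasure D]
    (hclass : IsMeasurableClass H D) {c : ℝ} (hc : 0 ≤ c) :
    ∃ G : (κ → Example X) → ENNReal, AEMeasurable G (.pi fun _ => D) ∧
      (∀ z, ∀ h ∈ H, ENNReal.ofReal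
        (exp |c * (∑ i, loss h (z i) - Fintype.card κ * error D h)|) ≤ G z) ∧
      ∫⁻ z, G z ∂(.pi fun _ => D) ≤
        ENNReal.ofReal (2 * (2 * Fintype.card κ + 1) ^ d * exp (Fintype.card κ * c ^ 2 / 2)) := by
  have hmp := measurePreserving_sumPiEquivProdPi_symm (X := fun _ : κ ⊕ κ => Example X)
    fun _ => D
  set Φ : (κ ⊕ κ → Example X) → ENNReal :=
    fun z => ENNReal.ofReal (exp (supLoss H (signedCoeff c fun _ => true) z)) with hΦ
  have hΦm : AEMeasurable Φ (.pi fun _ => D) := aemeasurable_ofReal_exp_supLoss hclass _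
  have hΦp := hΦm.comp_quasiMeasurePreserving hmp.quasiMeasurePreserving
  -- The majorant integrates the double-sample supremum over the second sample; Tonelli makes it
  -- a.e. measurable, so measurability of the supremum of deviations themselves is never needed.
  refine ⟨_, hΦp.lintegral_prod_right', fun z h hh => ?_, ?_⟩
  · refine (exp_abs_sum_sub_error_le D (hmeas h hh) c z).trans (lintegral_mono fun z' => ?_)
    refine ENNReal.ofReal_le_ofReal (exp_le_exp.2 ?_)
    refine le_trans (le_of_eq ?_) (abs_sum_le_supLoss _ _ hh)
    rw [sum_signedCoeff]
    simp [sign, MeasurableEquiv.coe_sumPiEquivProdPi_symm, Equiv.sumPiEquivProdPi]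
  · rw [← lintegral_prod _ hΦp]
    refine le_trans (le_of_eq ?_) (lintegral_exp_supLoss_le hne hd hclass hc)
    exact hmp.lintegral_comp_emb (MeasurableEquiv.measurableEmbedding _) Φ

end Symmetrization

/-! ### Uniform convergence and the theorem -/

section Uniform

open Real

variable {X : Type*} [MeasurableSpace X]

theorem deviation_pos {d m : ℕ} (hm : 0 < m) {δ : ℝ} (hδ0 : 0 < δ) (hδ1 : δ < 1) :
    0 < deviation d m δ := by
  have h1 : 0 < log (4 / δ) := log_pos (by rw [lt_div_iff₀ hδ0]; linarith)
  have h2 : 0 ≤ log (2 * m + 1) := log_nonneg (by linarith [m.cast_nonneg (α := ℝ)])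
  have : (0 : ℝ) < m := by exact_mod_cast hm
  unfold deviation
  positivity

theorem mul_deviation_sq {d m : ℕ} (hm : 0 < m) {δ : ℝ} (hδ0 : 0 < δ) (hδ1 : δ < 1) :
    m * deviation d m δ ^ 2 = 4 * (2 * d * log (2 * m + 1) + log (4 / δ)) := by
  have h1 : 0 < log (4 / δ) := log_pos (by rw [lt_div_iff₀ hδ0]; linarith)
  have h2 : 0 ≤ log (2 * m + 1) := log_nonneg (by linarith [m.cast_nonneg (α := ℝ)])
  have : (0 : ℝ) < m := by exact_mod_cast hm
  rw [deviation, mul_pow, sq_sqrt (by positivity)]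
  field_simp
  norm_num

/-- Compares the moment at `c = η` with `δ` times the Markov threshold `exp (m η²)`. Since `m η² /
2` is twice `2 d log (2m+1) + log (4/δ)`, there is room to spare. -/
theorem two_mul_pow_mul_exp_le {d m : ℕ} (hm : 0 < m) {δ : ℝ} (hδ0 : 0 < δ) (hδ1 : δ < 1) :
    2 * (2 * m + 1) ^ d * exp (m * deviation d m δ ^ 2 / 2) ≤
      δ * exp (m * deviation d m δ ^ 2) := by
  have hL : 0 ≤ log (2 * m + 1) := log_nonneg (by linarith [m.cast_nonneg (α := ℝ)])
  have hpow : ((2 * m + 1) ^ d : ℝ) = exp (d * log (2 * m + 1)) := by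
    rw [exp_nat_mul, exp_log (by positivity)]
  have h4 : 4 = δ * exp (log (4 / δ)) := by
    rw [exp_log (by positivity)]; field_simp
  have hl4 : 0 ≤ log (4 / δ) := log_nonneg (by rw [le_div_iff₀ hδ0]; linarith)
  have hdL : 0 ≤ d * log (2 * m + 1) := by positivity
  calc 2 * (2 * m + 1) ^ d * exp (m * deviation d m δ ^ 2 / 2)
      ≤ 4 * (2 * m + 1) ^ d * exp (m * deviation d m δ ^ 2 / 2) := by gcongr; norm_num
    _ = δ * exp (log (4 / δ) + d * log (2 * m + 1) + m * deviation d m δ ^ 2 / 2) := by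
        rw [hpow, exp_add, exp_add]
        nth_rewrite 1 [h4]
        ring
    _ ≤ _ := by
        gcongr
        rw [mul_deviation_sq hm hδ0 hδ1]
        linarith

/-- Uniform convergence over a class of finite VC dimension. -/
theorem exists_event_abs_empError_sub_error_le {H : Set (X → Bool)} (hne : H.Nonempty)
    (hmeas : ∀ h ∈ H, Measurable h) {D : Measure (Example X)} [IsProbabilityMeasure D]
    (hclass : IsMeasurableClass H D) {d : ℕ} (hd : vcDim H = d) {m : ℕ} (hm : 0 < m) {δ : ℝ}
    (hδ0 : 0 < δ) (hδ1 : δ < 1) :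
    ∃ E : Set (Fin m → Example X), MeasurableSet E ∧
      ENNReal.ofReal (1 - δ) ≤ Measure.pi (fun _ : Fin m => D) E ∧
      ∀ z ∈ E, ∀ h ∈ H, |empError z h - error D h| ≤ deviation d m δ := by
  have hη := deviation_pos (d := d) hm hδ0 hδ1
  obtain ⟨G, hG, hdom, hint⟩ := exists_majorant (κ := Fin m) hne hmeas hd hclass hη.le
  rw [Fintype.card_fin] at hint
  set μ := Measure.pi fun _ : Fin m => D
  set t := exp (m * deviation d m δ ^ 2) with ht
  have htpos : 0 < t := exp_pos _
  have hbad : μ {z | ENNReal.ofReal t ≤ G z} ≤ ENNReal.ofReal δ := by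
    refine (meas_ge_le_lintegral_div hG (by simpa using htpos) (by finiteness)).trans ?_
    refine ENNReal.div_le_of_le_mul (hint.trans ?_)
    rw [← ENNReal.ofReal_mul hδ0.le]
    exact ENNReal.ofReal_le_ofReal (two_mul_pow_mul_exp_le hm hδ0 hδ1)
  -- `G` is only a.e. measurable, so the bad set is enlarged to a measurable set of the same
  -- measure.
  refine ⟨(toMeasurable μ {z | ENNReal.ofReal t ≤ G z})ᶜ, (measurableSet_toMeasurable _ _).compl,
    ?_, fun z hz h hh => ?_⟩
  · rw [prob_compl_eq_one_sub (measurableSet_toMeasurable _ _), measure_toMeasurable,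
      ENNReal.ofReal_sub _ hδ0.le, ENNReal.ofReal_one]
    exact tsub_le_tsub_left hbad 1
  · have hz' : G z < ENNReal.ofReal t :=
      not_le.1 fun hle => hz (subset_toMeasurable _ _ hle)
    have hlt := (ENNReal.ofReal_lt_ofReal_iff htpos).1 ((hdom z h hh).trans_lt hz')
    have hm0 : (0 : ℝ) < m := by exact_mod_cast hm
    -- As `η` is both the exponent's coefficient and the target deviation, being below the threshold
    -- reads `m η |ε̂ - ε| < m η²`.
    have heq : deviation d m δ * (∑ i, loss h (z i) - m * error D h) =
        (m * deviation d m δ) * (empError z h - error D h) := by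
      rw [empError]; field_simp
    rw [ht, exp_lt_exp, Fintype.card_fin, heq, abs_mul, abs_of_pos (by positivity), sq,
      ← mul_assoc] at hlt
    exact (lt_of_mul_lt_mul_left hlt (by positivity)).le

end Uniform

end BridgingDomain

/-- With probability at least `1 - δ` over `m` independent labelled source examples, every
minimizer `h₁` of the empirical source error satisfies the target-error bound with a bridging
domain `B`. The divergences involve only the input marginals of the domains. -/
theorem mainTheorem1 {X : Type*} [MeasurableSpace X]
    (S B T : Measure (BridgingDomain.Example X))
    [IsProbabilityMeasure S] [IsProbabilityMeasure B] [IsProbabilityMeasure T]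
    (H : Set (X → Bool)) (hne : H.Nonempty) (hmeas : ∀ h ∈ H, Measurable h)
    (hclass : BridgingDomain.IsMeasurableClass H S)
    (d : ℕ) (hd : BridgingDomain.vcDim H = d)
    (m : ℕ) (hm : 0 < m) (δ : ℝ) (hδ0 : 0 < δ) (hδ1 : δ < 1) :
    ∃ E : Set (Fin m → BridgingDomain.Example X), MeasurableSet E ∧
      ENNReal.ofReal (1 - δ) ≤ Measure.pi (fun _ : Fin m => S) E ∧
      ∀ z ∈ E, ∀ h₁ : X → Bool, BridgingDomain.IsEmpiricalMinimizer H z h₁ →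
        BridgingDomain.error T h₁ ≤
          BridgingDomain.bestError H T + 1 / 2 * BridgingDomain.bestError H B
            + 2 * BridgingDomain.jointError H T S B
            + BridgingDomain.divergence H (BridgingDomain.mixture S.fst B.fst) T.fst
            + 1 / 2 * BridgingDomain.divergence H S.fst B.fst
            + 2 * BridgingDomain.deviation d m δ := by
  obtain ⟨E, hE, hprob, hdev⟩ := BridgingDomain.exists_event_abs_empError_sub_error_le hne hmeas
    hclass hd hm hδ0 hδ1
  refine ⟨E, hE, hprob, fun z hz h₁ hmin => ?_⟩
  refine BridgingDomain.error_le_of_forall_error_source_le S B T hmeas hmin.1 fun h hh => ?_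
  -- `ε_S(h₁) ≤ ε̂_S(h₁) + η ≤ ε̂_S(h) + η ≤ ε_S(h) + 2η`.
  linarith [(abs_le.1 (hdev z hz h₁ hmin.1)).1, (abs_le.1 (hdev z hz h hh)).2, hmin.2 h hh]
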